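/- Let $S$ be a set (possibly infinite) and let $(m_{s,t})_{s,t\in S}$ be a Coxeter matrix, i.e. a symmetric matrix with entries in $\{1,2,\dots\}\cup\{\infty\}$ such that $m_{s,t}=1$ exactly when $s=t$. The associated Artin–Tits monoid is the monoid $$M=\langle S \mid \underbrace{sts\cdots}_{m_{s,t}}=\underbrace{tst\cdots}_{m_{s,t}}\ \text{ for } s\neq t \text{ in } S \text{ with } m_{s,t}<\infty\rangle^{+}.$$ For $f,g\in M$ write $f\preceq g$ ($f$ left-divides $g$; $g$ is a right-multiple of $f$) if $g=fg'$ for some $g'\in M$; say that $f$ is a right-divisor of $g$ if $g=g'f$ for some $g'\in M$. A right-lcm of $f$ and $g$ is an element $h$ with $f\preceq h$, $g\preceq h$ and $h\preceq k$ for every $k$ with $f\preceq k$ and $g\preceq k$. An atom is an element $g$ whose only left-divisors are $1$ and $g$ (the element $1$ satisfies this condition; this matters only if $S=\emptyset$, since otherwise $1$ is a right-divisor of an element of $S$). A family $F\subseteq M$ is closed under right-lcm if the right-lcm of two elements of $F$ belongs to $F$ whenever it exists, and closed under right-divisor if every right-divisor of an element of $F$ belongs to $F$. A Garside family of a left-cancellative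 monoid $M$ with no nontrivial invertible element is a subset $F$ of $M$ containing $1$ such that every $g\in M$ admits an $F$-normal decomposition, i.e. a finite sequence $(s_1,\dots,s_p)$ of elements of $F$ with $s_1\cdots s_p=g$ and, for every $i<p$, $$\forall s\in F\ \forall f\in M\ \ (s\preceq f s_i s_{i+1}\ \Rightarrow\ s\preceq f s_i).$$ Proposition 2.2. Let $M$ be an Artin–Tits monoid. Then $M$ is left-cancellative, and $fg=1$ holds in $M$ only for $f=g=1$, so that the notion of a Garside family applies to $M$. A subset $F$ of $M$ is a Garside family if and only if it contains all atoms of $M$ and is closed under right-lcm and right-divisor. In particular, $M$ admits a unique smallest Garside family (with respect to inclusion), namely the closure of the atoms under right-lcm and right-divisor. -/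

import Mathlib

namespace ArtinTits

/-- The defining relations of the Artin–Tits monoid: for distinct generators `s`, `t` whose Coxeter
entry is finite (`0` encodes `∞` in `CoxeterMatrix`), the two alternating words in `s`, `t` of
length `C s t` are identified. -/
inductive BraidRel {S : Type*} (C : CoxeterMatrix S) : FreeMonoid S → FreeMonoid S → Prop
  | braid (s t : S) (hst : s ≠ t) (hfin : C s t ≠ 0) :
      BraidRel C (FreeMonoid.ofList (CoxeterSystem.alternatingWord s t (C s t)))
        (FreeMonoid.ofList (CoxeterSystem.alternatingWord t s (C s t)))

/-- The Artin–Tits monoid associated with a Coxeter matrix. -/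
abbrev ArtinTitsMonoid {S : Type*} (C : CoxeterMatrix S) : Type _ :=
  PresentedMonoid (BraidRel C)

section Monoid

variable {M : Type*} [Monoid M]

/-! In a noncommutative monoid, Mathlib's `f ∣ g` reads `∃ c, g = f * c`: it is left-divisibility. -/

/-- `f` is a right-divisor of `g`. -/
def IsRightDivisor (f g : M) : Prop := ∃ g' : M, g = g' * f

/-- `h` is a right-lcm (a least common right-multiple) of `f` and `g`. -/
def IsRightLcm (f g h : M) : Prop :=
  f ∣ h ∧ g ∣ h ∧ ∀ k : M, f ∣ k → g ∣ k → h ∣ k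

/-- An atom: an element `g` whose only left-divisors are `1` and `g`. With this wording the element
`1` of a monoid without nontrivial invertible elements satisfies the condition. -/
def IsAtomElement (g : M) : Prop := ∀ f : M, f ∣ g → f = 1 ∨ f = g

/-- A family is closed under right-lcm if a right-lcm of two of its elements, when there is one,
belongs to it. -/
def ClosedUnderRightLcm (F : Set M) : Prop :=
  ∀ f ∈ F, ∀ g ∈ F, ∀ h : M, IsRightLcm f g h → h ∈ F

/-- A family is closed under right-divisor if every right-divisor of an element of the family
belongs to it. -/
def ClosedUnderRightDivisor (F : Set M) : Prop :=
  ∀ g ∈ F, ∀ f : M, IsRightDivisor f g → f ∈ F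

/-- The condition imposed on two consecutive entries of an `F`-normal sequence. -/
def IsGreedyPair (F : Set M) (a b : M) : Prop :=
  ∀ s ∈ F, ∀ f : M, s ∣ f * a * b → s ∣ f * a

/-- The finite sequence `l` is an `F`-normal decomposition of `g`. -/
structure IsNormalDecomposition (F : Set M) (l : List M) (g : M) : Prop where
  prod_eq : l.prod = g
  mem : ∀ s ∈ l, s ∈ F
  greedy : ∀ (i : ℕ) (hi : i + 1 < l.length), IsGreedyPair F l[i] l[i + 1]

/-- A Garside family, for `M` left-cancellative without nontrivial invertible elements. -/
structure IsGarsideFamily (F : Set M) : Prop where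
  one_mem : (1 : M) ∈ F
  exists_normal : ∀ g : M, ∃ l : List M, IsNormalDecomposition F l g

/-- Membership in the closure of `A` under right-lcm and right-divisor. -/
inductive InClosure (A : Set M) : M → Prop
  | base (g : M) (hg : g ∈ A) : InClosure A g
  | rightLcm (f g h : M) (hf : InClosure A f) (hg : InClosure A g) (hh : IsRightLcm f g h) :
      InClosure A h
  | rightDivisor (f g : M) (hg : InClosure A g) (hf : IsRightDivisor f g) : InClosure A f

/-- The closure of a family `A` under right-lcm and right-divisor. -/
def lcmDivisorClosure (A : Set M) : Set M := {g | InClosure A g}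

end Monoid

end ArtinTits

/-! Granted left cancellation and right-lcms of elements with a common right-multiple, the
equivalence is short. If `F` is closed and contains the atoms, each `g` has a greatest left-divisor
in `F`; splitting it off repeatedly gives a normal decomposition, because complements of members of
`F` stay in `F` (`exists_right_complement_mem`). Conversely, the first entry of a normal
decomposition of `g` absorbs every member of `F` that divides a left-multiple of `g`
(`IsGarsideFamily.exists_head`). Applied to a right-divisor or a right-lcm `g`, this forces the
entry to be `g` itself.

The two granted facts come from the Coxeter group `W`. Its geometric representation and a parity
count of inversions yield the exchange condition. Hence reduced words lift consistently to `M`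
(`word_eq_of_isReduced`), and among the prefixes `u` of `v` with `ℓ(a u) = ℓ(a) + ℓ(u)` there is a
greatest one (`exists_max_prefix`). Multiplying `a` by that prefix and passing the rest of `v` on to
a tail defines an action of `M` on `W × M`. This action recovers `g` from `gen C s * g` and shows
that a common multiple of two generators begins with their full alternating word. -/

namespace ArtinTits

/-! ### Geometric representation: the exact order of a product of two generators. -/

section GeometricRepresentation

open Polynomial Module

/-- Powers of a product of two reflections have Chebyshev coefficients; with `x = -2 cos θ` one has
`x² - 2 = 2 cos 2θ`, so vanishing of these coefficients becomes a question about sines. -/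
theorem chebyshevS_eval_mul_sin (θ : ℝ) (n : ℤ) :
    (Chebyshev.S ℝ n).eval ((-2 * Real.cos θ) * (-2 * Real.cos θ) - 2) * Real.sin (2 * θ) =
      Real.sin ((n + 1) * (2 * θ)) := by
  rw [← Chebyshev.S_two_mul_real_cos, Real.cos_two_mul]
  ring_nf

theorem sin_two_pi_div_ne_zero {m : ℕ} (hm : 3 ≤ m) : Real.sin (2 * (Real.pi / m)) ≠ 0 := by
  have hm' : (3 : ℝ) ≤ m := by exact_mod_cast hm
  apply ne_of_gt
  apply Real.sin_pos_of_pos_of_lt_pi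
  · have := Real.pi_pos
    positivity
  · rw [← mul_div_assoc, div_lt_iff₀ (by linarith)]
    nlinarith [Real.pi_pos]

theorem cos_pi_div_ne_zero {m : ℕ} (hm : m ≠ 2) (hm1 : m ≠ 1) : Real.cos (Real.pi / m) ≠ 0 := by
  rcases Nat.eq_zero_or_pos m with rfl | h
  · simp
  intro h0
  apply sin_two_pi_div_ne_zero (m := m) (by lia)
  rw [Real.sin_two_mul, h0, mul_zero]

variable {S : Type*} (C : CoxeterMatrix S)

/-- The linear form defining the reflection of the geometric representation attached to `s`. An
entry `0` of the Coxeter matrix, which stands for `∞`, yields the value `-2`. -/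
noncomputable def coroot (s : S) : Dual ℝ (S →₀ ℝ) :=
  Finsupp.linearCombination ℝ fun t => -2 * Real.cos (Real.pi / C s t)

theorem coroot_single (s t : S) :
    coroot C s (Finsupp.single t 1) = -2 * Real.cos (Real.pi / C s t) := by
  simp [coroot]

theorem coroot_single_self (s : S) : coroot C s (Finsupp.single s 1) = 2 := by
  simp [coroot_single]

theorem coroot_single_symm (s t : S) :
    coroot C t (Finsupp.single s 1) = coroot C s (Finsupp.single t 1) := by
  rw [coroot_single, coroot_single, C.symmetric]

/-- The simple reflections of the geometric representation. -/
noncomputable def geomReflection (s : S) : (S →₀ ℝ) ≃ₗ[ℝ] (S →₀ ℝ) :=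
  reflection (coroot_single_self C s)

theorem geomReflection_mul_pow_eq_one (s t : S) :
    (geomReflection C s * geomReflection C t) ^ C s t = 1 := by
  by_cases hst : s = t
  · subst hst
    ext1 x
    simpa [geomReflection] using involutive_reflection (coroot_single_self C s) x
  have h1 := C.off_diagonal s t hst
  ext1 z
  rw [geomReflection, geomReflection, reflection_mul_reflection_pow_apply]
  simp only [coroot_single_symm C s t]
  rw [coroot_single]
  rcases eq_or_ne (C s t) 0 with h0 | h0
  · simp [h0]
  rcases eq_or_ne (C s t) 2 with h2 | h2
  · simp only [h2]
    norm_num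
    abel
  have hsin := sin_two_pi_div_ne_zero (m := C s t) (by lia)
  set m := C s t with hm
  set x := -2 * Real.cos (Real.pi / m) with hx
  have hm0 : (m : ℝ) ≠ 0 := by exact_mod_cast h0
  have key := fun n => chebyshevS_eval_mul_sin (Real.pi / m) n
  rw [← hx] at key
  -- The coefficient indices are floors of halves. For `m = 2k` the angle `k · 2π/m` is `π`; for `m
  -- = 2k + 1` the two relevant angles are `π + π/m` and `π - π/m`, whose sines cancel.
  rcases Nat.even_or_odd' m with ⟨k, hk | hk⟩
  · have e : ((m : ℤ) - 2) / 2 = k - 1 ∧ ((m : ℤ) - 1) / 2 = k - 1 := by lia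
    have : (Chebyshev.S ℝ ((k : ℤ) - 1)).eval (x * x - 2) = 0 := by
      apply (mul_eq_zero.mp _).resolve_right hsin
      rw [key]
      have : ((((k : ℤ) - 1 : ℤ) : ℝ) + 1) * (2 * (Real.pi / m)) = Real.pi := by
        have : (m : ℝ) = 2 * k := by exact_mod_cast hk
        push_cast
        field_simp
        rw [this]; ring
      rw [this, Real.sin_pi]
    rw [e.1, e.2, this]
    simp
  · have e : ((m : ℤ) - 2) / 2 = k - 1 ∧ ((m : ℤ) - 1) / 2 = k ∧ ((m : ℤ) - 3) / 2 = k - 1 ∧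
        (m : ℤ) / 2 = k := by lia
    have : (Chebyshev.S ℝ (k : ℤ)).eval (x * x - 2) +
        (Chebyshev.S ℝ ((k : ℤ) - 1)).eval (x * x - 2) = 0 := by
      apply (mul_eq_zero.mp _).resolve_right hsin
      rw [add_mul, key, key]
      have h3 : ((((k : ℤ)  : ℤ) : ℝ) + 1) * (2 * (Real.pi / m)) =
          Real.pi - (-(Real.pi / m)) := by
        have : (m : ℝ) = 2 * k + 1 := by exact_mod_cast hk
        push_cast
        field_simp
        rw [this]; ring
      have h4 : ((((k : ℤ) - 1 : ℤ) : ℝ) + 1) * (2 * (Real.pi / m)) =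
          Real.pi - Real.pi / m := by
        have : (m : ℝ) = 2 * k + 1 := by exact_mod_cast hk
        push_cast
        field_simp
        rw [this]; ring
      rw [h3, h4, Real.sin_pi_sub, Real.sin_pi_sub, Real.sin_neg]
      ring
    rw [e.1, e.2.1, e.2.2.1, e.2.2.2, this]
    simp

/-- If the power fixed the basis vector at `s`, its `t`-coordinate would give `S_{j-1} = 0`, and
then its `s`-coordinate `S_j = 1`. For finite `m ≥ 3` this means `cos (2πj/m) = 1`, so `m` would
divide `j`. -/
theorem geomReflection_mul_pow_ne_one {s t : S} (hst : s ≠ t) {j : ℕ} (hj : 0 < j)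
    (hjm : j < C s t ∨ C s t = 0) : (geomReflection C s * geomReflection C t) ^ j ≠ 1 := by
  intro hone
  have h1 := C.off_diagonal s t hst
  have h := reflection_mul_reflection_pow_apply_self (coroot_single_self C s)
    (coroot_single_self C t) j
  change ((geomReflection C s * geomReflection C t) ^ j) _ = _ at h
  rw [hone, LinearEquiv.coe_one, id] at h
  simp only [coroot_single_symm C s t] at h
  rw [coroot_single] at h
  have hs := DFunLike.congr_fun h s
  have ht := DFunLike.congr_fun h t
  simp only [Finsupp.add_apply, Finsupp.smul_apply, Finsupp.single_eq_same, smul_eq_mul,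
    Finsupp.single_eq_of_ne hst, Finsupp.single_eq_of_ne hst.symm, mul_zero, zero_add,
    mul_one, add_zero] at hs ht
  rcases eq_or_ne (C s t) 2 with h2 | h2
  · have : j = 1 := by lia
    subst this
    simp [h2] at hs
  have hcos := cos_pi_div_ne_zero h2 h1
  set m := C s t with hm
  have hS : (Chebyshev.S ℝ ((j : ℤ) - 1)).eval
      (-2 * Real.cos (Real.pi / m) * (-2 * Real.cos (Real.pi / m)) - 2) = 0 := by
    rcases mul_eq_zero.mp ht.symm with h | h
    · exact h
    · exact absurd h (by simpa using hcos)
  rw [hS, add_zero] at hs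
  -- When `m = 0`, division by zero makes the argument `2`, where `S_{j-1}` takes the value `j ≠ 0`.
  rcases Nat.eq_zero_or_pos m with h0 | h0
  · rw [h0] at hS
    norm_num at hS
    lia
  have key := fun n => chebyshevS_eval_mul_sin (Real.pi / m) n
  have hsin := sin_two_pi_div_ne_zero (m := m) (by lia)
  have k1 := key (j - 1)
  have k2 := key j
  rw [hS, zero_mul] at k1
  rw [← hs, one_mul] at k2
  push_cast at k1 k2
  rw [sub_add_cancel] at k1
  rw [add_mul, one_mul, Real.sin_add, ← k1, zero_mul, zero_add] at k2
  have hc : Real.cos (j * (2 * (Real.pi / m))) = 1 := by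
    apply mul_right_cancel₀ hsin
    rw [one_mul, ← k2]
  rw [Real.cos_eq_one_iff] at hc
  obtain ⟨n, hn⟩ := hc
  have hm0 : (m : ℝ) ≠ 0 := by exact_mod_cast h0.ne'
  have hnm : (n : ℝ) * m = j := by
    have := Real.pi_ne_zero
    field_simp at hn
    linarith
  have hnm' : n * m = j := by exact_mod_cast hnm
  have hlt : j < m := by lia
  have : 0 < n := by
    by_contra hn0
    nlinarith
  nlinarith

end GeometricRepresentation

variable {S W : Type*} [Group W] {C : CoxeterMatrix S} (cs : CoxeterSystem C W)

theorem simple_mul_simple_pow_ne_one {s t : S} (hst : s ≠ t) {j : ℕ} (hj : 0 < j)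
    (hjm : j < C s t ∨ C s t = 0) : (cs.simple s * cs.simple t) ^ j ≠ 1 := by
  intro h
  apply geomReflection_mul_pow_ne_one C hst hj hjm
  have hf : C.IsLiftable (geomReflection C) := geomReflection_mul_pow_eq_one C
  rw [← cs.lift_apply_simple hf s, ← cs.lift_apply_simple hf t, ← map_mul, ← map_pow, h, map_one]

end ArtinTits

namespace ArtinTits

/-! ### Alternating words, inversion parity and the exchange condition. -/

section AlternatingList

variable {α : Type*}

/-- The word of length `k` that alternates between `s` and `t`, starting with `s`. -/
def altList (s t : α) : ℕ → List α
  | 0 => []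
  | k + 1 => s :: altList t s k

@[simp]
theorem length_altList (s t : α) (k : ℕ) : (altList s t k).length = k := by
  induction k generalizing s t with
  | zero => rfl
  | succ k ih => simp [altList, ih]

theorem altList_add (s t : α) (k j : ℕ) : altList s t (k + j) =
    altList s t k ++ if Even k then altList s t j else altList t s j := by
  induction k generalizing s t with
  | zero => simp [altList]
  | succ k ih =>
    rw [Nat.add_right_comm, altList, ih, altList]
    by_cases h : Even k <;> simp [Nat.even_add_one, h]

theorem alternatingWord_eq_altList (s t : α) (k : ℕ) : CoxeterSystem.alternatingWord s t k =
    if Even k then altList s t k else altList t s k := by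
  induction k with
  | zero => simp [CoxeterSystem.alternatingWord, altList]
  | succ k ih =>
    rw [CoxeterSystem.alternatingWord_succ', ih]
    by_cases h : Even k <;> simp [Nat.even_add_one, h, altList]

end AlternatingList

variable {S W : Type*} [Group W] {C : CoxeterMatrix S} (cs : CoxeterSystem C W)

theorem leftInvSeq_altList (s t : S) (k : ℕ) : cs.leftInvSeq (altList s t k) =
    (List.range k).map fun i => (cs.simple s * cs.simple t) ^ i * cs.simple s := by
  induction k generalizing s t with
  | zero => rfl
  | succ k ih =>
    rw [altList, CoxeterSystem.leftInvSeq, ih, List.range_succ_eq_map, List.map_cons,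
      List.map_map, List.map_map]
    congr 1
    · simp
    · apply List.map_congr_left
      intro i _
      have h : ∀ i : ℕ, (cs.simple s * cs.simple t) ^ i * cs.simple s =
          cs.simple s * (cs.simple t * cs.simple s) ^ i := by
        intro i
        induction i with
        | zero => simp
        | succ i hi => rw [pow_succ', mul_assoc, hi, pow_succ', mul_assoc, mul_assoc]
      simp only [Function.comp_apply, MulAut.conj_apply, CoxeterSystem.inv_simple]
      rw [pow_succ, mul_assoc, mul_assoc, ← mul_assoc, ← mul_assoc, ← h]
      simp only [mul_assoc]

theorem wordProd_altList_two_mul (s t : S) (k : ℕ) :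
    cs.wordProd (altList s t (2 * k)) = (cs.simple s * cs.simple t) ^ k := by
  induction k with
  | zero => simp [altList]
  | succ k ih =>
    rw [mul_add_one, altList, altList, cs.wordProd_cons, cs.wordProd_cons, ih, pow_succ', mul_assoc]

open Classical in
/-- The permutation of `W × ℤ/2` attached to a simple reflection, whose compositions count
inversions modulo two. -/
noncomputable def inversionStep (s : S) : Equiv.Perm (W × ZMod 2) :=
  Function.Involutive.toPerm
    (fun p => (cs.simple s * p.1 * cs.simple s, p.2 + if p.1 = cs.simple s then 1 else 0)) (by
      rintro ⟨x, e⟩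
      have : cs.simple s * x * cs.simple s = cs.simple s ↔ x = cs.simple s := by
        constructor
        · intro h
          have := congrArg (fun y => cs.simple s * y * cs.simple s) h
          simpa [mul_assoc] using this
        · rintro rfl; simp
      ext
      · simp [mul_assoc]
      · simp only [this, add_assoc]
        split_ifs
        · rw [show (1 : ZMod 2) + 1 = 0 from rfl, add_zero]
        · simp)

open Classical in
theorem inversionStep_apply (s : S) (p : W × ZMod 2) : inversionStep cs s p =
    (cs.simple s * p.1 * cs.simple s, p.2 + if p.1 = cs.simple s then 1 else 0) := rfl

open Classical in
theorem prod_map_inversionStep_apply (ω : List S) (p : W × ZMod 2) :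
    (ω.map (inversionStep cs)).prod p = (cs.wordProd ω * p.1 * (cs.wordProd ω)⁻¹,
      p.2 + (List.count p.1 (cs.rightInvSeq ω) : ℕ)) := by
  induction ω with
  | nil => simp
  | cons s ω ih =>
    rw [List.map_cons, List.prod_cons, Equiv.Perm.mul_apply, ih, inversionStep_apply]
    ext
    · simp [cs.wordProd_cons, mul_assoc]
    · simp only [CoxeterSystem.rightInvSeq, List.count_cons, Nat.cast_add, add_assoc]
      congr 2
      have : (cs.wordProd ω * p.1 * (cs.wordProd ω)⁻¹ = cs.simple s) ↔
          (cs.wordProd ω)⁻¹ * cs.simple s * cs.wordProd ω = p.1 := by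
        rw [mul_inv_eq_iff_eq_mul, mul_assoc, inv_mul_eq_iff_eq_mul, eq_comm]
      simp [this]

theorem inversionStep_isLiftable : C.IsLiftable (inversionStep cs) := by
  classical
  intro s t
  have hprod : ∀ k, ((altList s t (2 * k)).map (inversionStep cs)).prod =
      (inversionStep cs s * inversionStep cs t) ^ k := by
    intro k
    induction k with
    | zero => simp [altList]
    | succ k ih =>
      rw [mul_add_one, altList, altList, List.map_cons, List.map_cons, List.prod_cons,
        List.prod_cons, ih, pow_succ', mul_assoc]
  rw [← hprod]
  ext1 p
  have hone := cs.simple_mul_simple_pow s t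
  have hrev : (cs.rightInvSeq (altList s t (2 * C s t))).count p.1 =
      (cs.leftInvSeq (altList t s (2 * C s t))).count p.1 := by
    have : (altList t s (2 * C s t)).reverse = altList s t (2 * C s t) := by
      have : ∀ k, (altList t s (2 * k)).reverse = altList s t (2 * k) := by
        intro k
        induction k with
        | zero => rfl
        | succ k ih =>
          rw [mul_add_one, altList, altList, List.reverse_cons, List.reverse_cons, ih, altList_add]
          simp [altList]
      exact this _
    rw [← this, cs.rightInvSeq_reverse, List.count_reverse]
  -- Since `(ts)^m = 1`, the `2m` inversions repeat with period `m`, so each reflection is counted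
  -- an even number of times.
  have hcount : ∃ n, (cs.leftInvSeq (altList t s (2 * C s t))).count p.1 = n + n := by
    rw [leftInvSeq_altList, two_mul, List.range_add, List.map_append, List.map_map,
      List.count_append]
    refine ⟨_, congrArg _ ?_⟩
    congr 1
    apply List.map_congr_left
    intro i _
    rw [Function.comp_apply, pow_add, C.symmetric s t, cs.simple_mul_simple_pow t s, one_mul]
  obtain ⟨n, hn⟩ := hcount
  rw [prod_map_inversionStep_apply, wordProd_altList_two_mul, hone, hrev, hn]
  ext
  · simp
  · simp [CharTwo.add_self_eq_zero]

/-- The action of a Coxeter group on `W × ℤ/2` that counts inversions modulo two. -/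
noncomputable def inversionHom : W →* Equiv.Perm (W × ZMod 2) :=
  cs.lift ⟨inversionStep cs, inversionStep_isLiftable cs⟩

theorem inversionHom_simple (s : S) : inversionHom cs (cs.simple s) = inversionStep cs s :=
  cs.lift_apply_simple _ s

open Classical in
theorem inversionHom_wordProd_apply (ω : List S) (p : W × ZMod 2) :
    inversionHom cs (cs.wordProd ω) p = (cs.wordProd ω * p.1 * (cs.wordProd ω)⁻¹,
      p.2 + (List.count p.1 (cs.rightInvSeq ω) : ℕ)) := by
  rw [← prod_map_inversionStep_apply, CoxeterSystem.wordProd, map_list_prod, List.map_map]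
  congr 3
  funext s
  exact inversionHom_simple cs s

open Classical in
-- The parity is the second coordinate of the action of the group element on `(t, 0)`, hence
-- independent of the word.
theorem count_rightInvSeq_congr {ω ω' : List S} (h : cs.wordProd ω = cs.wordProd ω') (t : W) :
    (List.count t (cs.rightInvSeq ω) : ZMod 2) = (List.count t (cs.rightInvSeq ω') : ℕ) := by
  have h1 := inversionHom_wordProd_apply cs ω (t, 0)
  rw [h, inversionHom_wordProd_apply] at h1
  simpa using (congrArg Prod.snd h1).symm

open Classical in
theorem count_leftInvSeq_congr {ω ω' : List S} (h : cs.wordProd ω = cs.wordProd ω') (t : W) :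
    (List.count t (cs.leftInvSeq ω) : ZMod 2) = (List.count t (cs.leftInvSeq ω') : ℕ) := by
  rw [← List.count_reverse, ← cs.rightInvSeq_reverse, ← List.count_reverse (l := cs.leftInvSeq ω'),
    ← cs.rightInvSeq_reverse]
  exact count_rightInvSeq_congr cs (by rw [cs.wordProd_reverse, cs.wordProd_reverse, h]) t

/-- A reflection listed once has odd count, so it is listed for every word of the same element,
including a shortest one. -/
theorem isReduced_of_nodup_leftInvSeq {ω : List S} (h : (cs.leftInvSeq ω).Nodup) :
    cs.IsReduced ω := by
  classical
  obtain ⟨ω', hω', he⟩ := cs.exists_isReduced (cs.wordProd ω)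
  apply le_antisymm (cs.length_wordProd_le ω)
  rw [he, hω', ← cs.length_leftInvSeq ω, ← cs.length_leftInvSeq ω']
  apply (List.subperm_of_subset h _).length_le
  intro t ht
  have hc := count_leftInvSeq_congr cs he t
  rw [List.count_eq_one_of_mem h ht] at hc
  by_contra hn
  rw [List.count_eq_zero_of_not_mem hn] at hc
  simp at hc

/-- The exchange condition for a left descent. -/
theorem exists_simple_mul_eq_wordProd_eraseIdx {ω : List S} {s : S}
    (h : cs.IsLeftDescent (cs.wordProd ω) s) :
    ∃ j < ω.length, cs.simple s * cs.wordProd ω = cs.wordProd (ω.eraseIdx j) := by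
  classical
  obtain ⟨ω', hω', he⟩ := cs.exists_isReduced (cs.simple s * cs.wordProd ω)
  -- In the word `s :: ω'` the reflection `s` is an inversion exactly once; by parity it also occurs
  -- for `ω`, and its position is the letter to delete.
  have hω : cs.wordProd ω = cs.wordProd (s :: ω') := by
    rw [cs.wordProd_cons, ← he, cs.simple_mul_simple_cancel_left]
  have hnot : cs.simple s ∉ cs.leftInvSeq ω' := by
    intro hmem
    have := (cs.isLeftInversion_of_mem_leftInvSeq hω' hmem).2
    rw [← he, cs.simple_mul_simple_cancel_left] at this
    exact lt_asymm this h
  have hc := count_leftInvSeq_congr cs hω (cs.simple s)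
  have hconj : cs.simple s ∉ (cs.leftInvSeq ω').map (MulAut.conj (cs.simple s)) := by
    intro hmem
    obtain ⟨x, hx, hxs⟩ := List.mem_map.mp hmem
    have : x = cs.simple s := by
      rw [MulAut.conj_apply, cs.inv_simple] at hxs
      have := congrArg (fun y => cs.simple s * y * cs.simple s) hxs
      simpa [mul_assoc] using this
    exact hnot (this ▸ hx)
  rw [CoxeterSystem.leftInvSeq, List.count_cons_self, List.count_eq_zero_of_not_mem hconj] at hc
  have hmem : cs.simple s ∈ cs.leftInvSeq ω := by
    by_contra hn
    rw [List.count_eq_zero_of_not_mem hn] at hc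
    simp at hc
  obtain ⟨j, hj, hjs⟩ := List.mem_iff_getElem.mp hmem
  refine ⟨j, by simpa using hj, ?_⟩
  rw [← cs.getD_leftInvSeq_mul_wordProd, List.getD_eq_getElem _ _ hj, hjs]

theorem isReduced_altList {s t : S} (hst : s ≠ t) {k : ℕ} (hk : k ≤ C s t ∨ C s t = 0) :
    cs.IsReduced (altList s t k) := by
  apply isReduced_of_nodup_leftInvSeq
  rw [leftInvSeq_altList]
  apply List.Nodup.map_on _ List.nodup_range
  have key : ∀ i j : ℕ, i < j → j < k →
      (cs.simple s * cs.simple t) ^ i * cs.simple s ≠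
        (cs.simple s * cs.simple t) ^ j * cs.simple s := by
    intro i j hij hj h
    have h' := mul_right_cancel h
    obtain ⟨d, rfl⟩ := Nat.exists_eq_add_of_lt hij
    rw [add_assoc, pow_add, left_eq_mul] at h'
    exact simple_mul_simple_pow_ne_one cs hst (by lia) (by lia) h'
  intro i hi j hj h
  rw [List.mem_range] at hi hj
  rcases lt_trichotomy i j with hlt | heq | hlt
  · exact absurd h (key i j hlt hj)
  · exact heq
  · exact absurd h.symm (key j i hlt hi)

end ArtinTits

namespace ArtinTits

variable {S W : Type*} [Group W] {C : CoxeterMatrix S} (cs : CoxeterSystem C W)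

/-! ### Two descents: alternating prefixes and dihedral longest elements. -/

section Dihedral

theorem exists_eq_wordProd_altList_mul_of_isLeftDescent {s t : S} (hst : s ≠ t) {w : W}
    (hs : cs.IsLeftDescent w s) (ht : cs.IsLeftDescent w t) {k : ℕ}
    (hk : k ≤ C s t ∨ C s t = 0) :
    ∃ v, w = cs.wordProd (altList s t k) * v ∧ cs.length w = k + cs.length v := by
  induction k generalizing s t with
  | zero => exact ⟨w, by simp [altList]⟩
  | succ k ih =>
    obtain ⟨v, hv, hl⟩ := ih hst.symm ht hs (by rw [C.symmetric t s]; lia)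
    obtain ⟨c, hc, hvc⟩ := cs.exists_isReduced v
    have hw : w = cs.wordProd (altList t s k ++ c) := by rw [cs.wordProd_append, hv, hvc]
    obtain ⟨j, hj, he⟩ := exists_simple_mul_eq_wordProd_eraseIdx cs (hw ▸ hs)
    rw [← hw] at he
    -- Deleting a letter inside the alternating prefix would write the reduced alternating word of
    -- length `k + 1` with only `k - 1` letters.
    rcases lt_or_ge j k with hjk | hjk
    · exfalso
      rw [List.eraseIdx_append_of_lt_length (by simpa using hjk), cs.wordProd_append, hv, hvc,
        ← mul_assoc] at he
      have he' := mul_right_cancel he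
      rw [← cs.wordProd_cons] at he'
      have h1 : cs.IsReduced (altList s t (k + 1)) := isReduced_altList cs hst hk
      have h2 := cs.length_wordProd_le ((altList t s k).eraseIdx j)
      rw [← he'] at h2
      have h3 := List.length_eraseIdx_add_one (l := altList t s k) (i := j) (by simpa using hjk)
      have h4 := h1.eq
      rw [altList] at h4
      simp at h3 h4
      lia
    · rw [List.eraseIdx_append_of_length_le (by simpa using hjk), cs.wordProd_append] at he
      set d := c.eraseIdx (j - (altList t s k).length) with hd
      have hw' : w = cs.wordProd (altList s t (k + 1)) * cs.wordProd d := by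
        rw [altList, cs.wordProd_cons, mul_assoc, ← he, cs.simple_mul_simple_cancel_left]
      refine ⟨_, hw', ?_⟩
      have hlen : d.length + 1 = c.length := List.length_eraseIdx_add_one (by simp at hj ⊢; lia)
      have h1 := cs.length_wordProd_le d
      have h2 := cs.length_mul_le (cs.wordProd (altList s t (k + 1))) (cs.wordProd d)
      have h3 := cs.length_wordProd_le (altList s t (k + 1))
      rw [← hw'] at h2
      rw [hvc, hc] at hl
      simp at h3
      lia

theorem coxeterEntry_ne_zero_of_isLeftDescent {s t : S} (hst : s ≠ t) {w : W}
    (hs : cs.IsLeftDescent w s) (ht : cs.IsLeftDescent w t) : C s t ≠ 0 := by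
  intro h0
  -- An infinite entry would allow alternating prefixes longer than `w` itself.
  obtain ⟨v, -, hv⟩ := exists_eq_wordProd_altList_mul_of_isLeftDescent cs hst hs ht
    (k := cs.length w + 1) (Or.inr h0)
  lia

theorem wordProd_altList_braid (s t : S) :
    cs.wordProd (altList s t (C s t)) = cs.wordProd (altList t s (C s t)) := by
  have h := cs.wordProd_braidWord_eq s t
  rw [CoxeterSystem.braidWord, CoxeterSystem.braidWord, C.symmetric t s,
    alternatingWord_eq_altList, alternatingWord_eq_altList] at h
  split_ifs at h
  · exact h
  · exact h.symm

theorem isLeftDescent_of_eq_simple_mul {w v : W} {s : S} (h : w = cs.simple s * v)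
    (hl : cs.length v < cs.length w) : cs.IsLeftDescent w s := by
  rw [CoxeterSystem.IsLeftDescent]
  rwa [h, cs.simple_mul_simple_cancel_left, ← h]

/-- If the length dropped at some letter, the product would have both descents and begin with the
full alternating word; cancelling the letters already placed leaves a nonempty alternating prefix of
`w`, a descent that was excluded. -/
theorem length_wordProd_altList_mul {s t : S} (hst : s ≠ t) {w : W}
    (hs : ¬ cs.IsLeftDescent w s) (ht : ¬ cs.IsLeftDescent w t) {k : ℕ} (hk : k ≤ C s t) :
    cs.length (cs.wordProd (altList s t k) * w) = k + cs.length w := by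
  induction k generalizing s t with
  | zero => simp [altList]
  | succ k ih =>
    have ihk := ih hst.symm ht hs (by rw [C.symmetric]; lia)
    rw [altList, cs.wordProd_cons, mul_assoc]
    set y := cs.wordProd (altList t s k) * w with hy
    rcases cs.length_simple_mul y s with h | h
    · lia
    exfalso
    have hys : cs.IsLeftDescent y s := by rw [CoxeterSystem.IsLeftDescent]; lia
    rcases k with _ | k
    · simp [altList] at hy
      exact hs (hy ▸ hys)
    have hyt : cs.IsLeftDescent y t := by
      apply isLeftDescent_of_eq_simple_mul cs (v := cs.wordProd (altList s t k) * w)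
      · rw [hy, altList, cs.wordProd_cons, mul_assoc]
      · have := cs.length_mul_le (cs.wordProd (altList s t k)) w
        have := cs.length_wordProd_le (altList s t k)
        simp at this
        lia
    obtain ⟨v, hv, hlv⟩ := exists_eq_wordProd_altList_mul_of_isLeftDescent cs hst.symm hyt hys
      (k := C s t) (by rw [C.symmetric]; lia)
    obtain ⟨j, hj⟩ : ∃ j, C s t = (k + 1) + (j + 1) := ⟨C s t - (k + 2), by lia⟩
    have hdesc : ∀ p q : S, w = cs.wordProd (altList p q (j + 1)) * v → cs.IsLeftDescent w p := by
      intro p q hpq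
      apply isLeftDescent_of_eq_simple_mul cs (v := cs.wordProd (altList q p j) * v)
      · rw [hpq, altList, cs.wordProd_cons, mul_assoc]
      · have := cs.length_mul_le (cs.wordProd (altList q p j)) v
        have := cs.length_wordProd_le (altList q p j)
        simp at this
        lia
    rw [hy, hj, altList_add t s (k + 1) (j + 1), cs.wordProd_append, mul_assoc, mul_right_inj] at hv
    split_ifs at hv
    · exact ht (hdesc _ _ hv)
    · exact hs (hdesc _ _ hv)

theorem exists_join_of_isLeftDescent {s t : S} (hst : s ≠ t) {w : W}
    (hs : cs.IsLeftDescent w s) (ht : cs.IsLeftDescent w t) :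
    ∃ v, w = cs.wordProd (altList s t (C s t)) * v ∧ cs.length w = C s t + cs.length v :=
  exists_eq_wordProd_altList_mul_of_isLeftDescent cs hst hs ht (Or.inl le_rfl)

theorem length_mul_wordProd_altList {s t : S} (hst : s ≠ t) {w : W}
    (hs : ¬ cs.IsRightDescent w s) (ht : ¬ cs.IsRightDescent w t) :
    cs.length (w * cs.wordProd (altList s t (C s t))) = cs.length w + C s t := by
  -- The full alternating word represents an involution, so the left-handed statement transfers
  -- through inverses.
  have hrev : cs.wordProd (altList s t (C s t)).reverse = cs.wordProd (altList s t (C s t)) := by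
    have : ∀ k, (altList s t k).reverse = if Even k then altList t s k else altList s t k := by
      intro k
      induction k generalizing s t with
      | zero => rfl
      | succ k ih =>
        rw [altList, List.reverse_cons, ih hst.symm ht hs]
        have h1 := altList_add s t k 1
        have h2 := altList_add t s k 1
        by_cases hk : Even k
        · rw [if_pos hk] at h1 ⊢
          rw [if_neg (by simpa [Nat.even_add_one] using hk)]
          exact h1.symm
        · rw [if_neg hk] at h2 ⊢
          rw [if_pos (by simpa [Nat.even_add_one] using hk)]
          exact h2.symm
    rw [this]
    split_ifs
    · exact (wordProd_altList_braid cs s t).symm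
    · rfl
  rw [← cs.isLeftDescent_inv_iff] at hs ht
  have h := length_wordProd_altList_mul cs hst hs ht le_rfl
  rw [← cs.length_inv, mul_inv_rev, inv_inv, ← cs.wordProd_reverse, hrev, cs.length_inv] at h
  lia

end Dihedral

/-! ### Prefix order and greatest length-additive prefixes. -/

section WeakOrder

/-- The prefix order (left weak order) of a Coxeter group. -/
def IsPrefix (u w : W) : Prop := ∃ v, w = u * v ∧ cs.length w = cs.length u + cs.length v

variable {cs}

theorem IsPrefix.refl (w : W) : IsPrefix cs w w := ⟨1, by simp⟩

theorem IsPrefix.length_le {u w : W} (h : IsPrefix cs u w) : cs.length u ≤ cs.length w := by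
  obtain ⟨v, -, h⟩ := h
  lia

theorem IsPrefix.trans {u v w : W} (h : IsPrefix cs u v) (h' : IsPrefix cs v w) :
    IsPrefix cs u w := by
  obtain ⟨x, rfl, hx⟩ := h
  obtain ⟨y, rfl, hy⟩ := h'
  refine ⟨x * y, mul_assoc _ _ _, ?_⟩
  have h1 := cs.length_mul_le x y
  have h2 := cs.length_mul_le u (x * y)
  rw [← mul_assoc] at h2
  lia

theorem IsPrefix.eq_of_length_le {u w : W} (h : IsPrefix cs u w)
    (hl : cs.length w ≤ cs.length u) : u = w := by
  obtain ⟨x, rfl, hx⟩ := h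
  have : x = 1 := cs.length_eq_zero_iff.mp (by lia)
  rw [this, mul_one]

/-- Left translation by an element with additive lengths reflects and preserves the prefix
order. -/
theorem isPrefix_mul_left_iff {a u w : W} (hw : cs.length (a * w) = cs.length a + cs.length w)
    (hu : cs.length (a * u) = cs.length a + cs.length u) :
    IsPrefix cs (a * u) (a * w) ↔ IsPrefix cs u w := by
  constructor
  · rintro ⟨x, hx, hl⟩
    rw [mul_assoc, mul_right_inj] at hx
    exact ⟨x, hx, by lia⟩
  · rintro ⟨x, rfl, hl⟩
    exact ⟨x, by rw [mul_assoc], by lia⟩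

theorem length_mul_of_isPrefix {a u w : W}
    (hw : cs.length (a * w) = cs.length a + cs.length w) (h : IsPrefix cs u w) :
    cs.length (a * u) = cs.length a + cs.length u := by
  obtain ⟨x, rfl, hl⟩ := h
  have h1 := cs.length_mul_le (a * u) x
  have h2 := cs.length_mul_le a u
  rw [mul_assoc] at h1
  lia

theorem IsPrefix.exists_simple {u w : W} (h : IsPrefix cs u w) (hne : u ≠ w) :
    ∃ s, cs.length (u * cs.simple s) = cs.length u + 1 ∧ IsPrefix cs (u * cs.simple s) w := by
  obtain ⟨x, rfl, hl⟩ := h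
  have hx : x ≠ 1 := by rintro rfl; simp at hne
  obtain ⟨s, hs⟩ := cs.exists_leftDescent_of_ne_one hx
  rw [cs.isLeftDescent_iff] at hs
  have e : u * x = u * cs.simple s * (cs.simple s * x) := by simp [mul_assoc]
  have h1 := cs.length_mul_le (u * cs.simple s) (cs.simple s * x)
  have h2 := cs.length_mul_le u (cs.simple s)
  rw [← e] at h1
  rw [cs.length_simple] at h2
  exact ⟨s, by lia, cs.simple s * x, e, by lia⟩

theorem isPrefix_mul_simple_iff {u x : W} {s : S}
    (hu : cs.length (u * x) = cs.length u + cs.length x)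
    (hs : cs.length (u * cs.simple s) = cs.length u + 1) :
    IsPrefix cs (u * cs.simple s) (u * x) ↔ cs.IsLeftDescent x s := by
  rw [isPrefix_mul_left_iff hu (by rw [hs, cs.length_simple])]
  constructor
  · rintro ⟨y, rfl, hl⟩
    rw [cs.length_simple] at hl
    exact isLeftDescent_of_eq_simple_mul cs rfl (by lia)
  · intro h
    rw [cs.isLeftDescent_iff] at h
    exact ⟨cs.simple s * x, by simp, by rw [cs.length_simple]; lia⟩

/-- For `s ≠ t` the bound is `u` times the full alternating element. It remains length-additive
under `a` because `a * u` has neither `s` nor `t` as a right descent. -/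
theorem exists_common_upper_bound_step {u w : W} {s t : S}
    (hs : cs.length (u * cs.simple s) = cs.length u + 1)
    (ht : cs.length (u * cs.simple t) = cs.length u + 1)
    (hsw : IsPrefix cs (u * cs.simple s) w) (htw : IsPrefix cs (u * cs.simple t) w) :
    ∃ z, IsPrefix cs (u * cs.simple s) z ∧ IsPrefix cs (u * cs.simple t) z ∧ IsPrefix cs z w ∧
      ∀ a, cs.length (a * (u * cs.simple s)) = cs.length a + cs.length (u * cs.simple s) →
        cs.length (a * (u * cs.simple t)) = cs.length a + cs.length (u * cs.simple t) →
        cs.length (a * z) = cs.length a + cs.length z := by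
  rcases eq_or_ne s t with rfl | hst
  · exact ⟨_, IsPrefix.refl _, IsPrefix.refl _, hsw, fun a ha _ => ha⟩
  obtain ⟨x, rfl, hx⟩ : IsPrefix cs u w :=
    IsPrefix.trans ⟨cs.simple s, rfl, by rw [hs, cs.length_simple]⟩ hsw
  have hs' := (isPrefix_mul_simple_iff hx hs).mp hsw
  have ht' := (isPrefix_mul_simple_iff hx ht).mp htw
  obtain ⟨y, rfl, hy⟩ := exists_join_of_isLeftDescent cs hst hs' ht'
  set m := C s t with hm
  have hm0 : m ≠ 0 := coxeterEntry_ne_zero_of_isLeftDescent cs hst hs' ht'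
  set D := cs.wordProd (altList s t m) with hD
  have hDl : cs.length D = m := by
    simpa using (isReduced_altList cs hst (k := m) (Or.inl le_rfl)).eq
  have huD : cs.length (u * D) = cs.length u + m := by
    have h1 := cs.length_mul_le (u * D) y
    have h2 := cs.length_mul_le u D
    rw [mul_assoc] at h1
    lia
  have hDs : cs.IsLeftDescent D s := by
    obtain ⟨k, hk⟩ := Nat.exists_eq_succ_of_ne_zero hm0
    apply isLeftDescent_of_eq_simple_mul cs (v := cs.wordProd (altList t s k))
    · rw [hD, hk, Nat.succ_eq_add_one, altList, cs.wordProd_cons]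
    · have := cs.length_wordProd_le (altList t s k)
      simp at this
      lia
  have hDt : cs.IsLeftDescent D t := by
    obtain ⟨k, hk⟩ := Nat.exists_eq_succ_of_ne_zero hm0
    apply isLeftDescent_of_eq_simple_mul cs (v := cs.wordProd (altList s t k))
    · rw [hD, hm, wordProd_altList_braid, ← hm, hk, Nat.succ_eq_add_one, altList, cs.wordProd_cons]
    · have := cs.length_wordProd_le (altList s t k)
      simp at this
      lia
  refine ⟨u * D, (isPrefix_mul_simple_iff (by lia) hs).mpr hDs,
    (isPrefix_mul_simple_iff (by lia) ht).mpr hDt, ⟨y, by rw [mul_assoc], by lia⟩, ?_⟩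
  intro a has hat
  have hau : cs.length (a * u) = cs.length a + cs.length u :=
    length_mul_of_isPrefix has ⟨cs.simple s, rfl, by rw [hs, cs.length_simple]⟩
  rw [← mul_assoc, length_mul_wordProd_altList cs hst, hau, huD, hm, add_assoc]
  · rw [cs.not_isRightDescent_iff, mul_assoc, has, hs, hau, add_assoc]
  · rw [cs.not_isRightDescent_iff, mul_assoc, hat, ht, hau, add_assoc]

/-- A diamond argument as in Newman's lemma: join the first steps from `x` towards `y` and `z`
locally, then recurse from these two higher points. The number `n` bounds the distance from `x` up
to `v`. -/
theorem exists_common_upper_bound (a v : W) (n : ℕ) : ∀ x y z : W,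
    cs.length v ≤ cs.length x + n → IsPrefix cs x y → IsPrefix cs x z →
    IsPrefix cs y v → IsPrefix cs z v →
    cs.length (a * y) = cs.length a + cs.length y → cs.length (a * z) = cs.length a + cs.length z →
    ∃ p, IsPrefix cs y p ∧ IsPrefix cs z p ∧ IsPrefix cs p v ∧
      cs.length (a * p) = cs.length a + cs.length p := by
  induction n with
  | zero =>
    intro x y z hn hxy hxz hyv hzv hay haz
    have := hyv.length_le
    have := hzv.length_le
    obtain rfl := hxy.eq_of_length_le (by lia)
    obtain rfl := hxz.eq_of_length_le (by lia)
    exact ⟨x, IsPrefix.refl _, IsPrefix.refl _, hyv, hay⟩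
  | succ n ih =>
    intro x y z hn hxy hxz hyv hzv hay haz
    rcases eq_or_ne x y with rfl | hy
    · exact ⟨z, hxz, IsPrefix.refl _, hzv, haz⟩
    rcases eq_or_ne x z with rfl | hz
    · exact ⟨y, IsPrefix.refl _, hxy, hyv, hay⟩
    obtain ⟨s, hs, hsy⟩ := hxy.exists_simple hy
    obtain ⟨t, ht, htz⟩ := hxz.exists_simple hz
    obtain ⟨q, hsq, htq, hqv, hq⟩ :=
      exists_common_upper_bound_step hs ht (hsy.trans hyv) (htz.trans hzv)
    have haq := hq a (length_mul_of_isPrefix hay hsy) (length_mul_of_isPrefix haz htz)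
    obtain ⟨p, hyp, hqp, hpv, hap⟩ := ih _ y q (by lia) hsy hsq hyv hqv hay haq
    obtain ⟨r, hpr, hzr, hrv, har⟩ := ih _ p z (by lia) (htq.trans hqp) htz hpv hzv hap haz
    exact ⟨r, hyp.trans hpr, hzr, hrv, har⟩

/-- A prefix of maximal length is greatest, since any competitor has an admissible common upper
bound with it. -/
theorem exists_max_prefix (a v : W) : ∃ v', IsPrefix cs v' v ∧
    cs.length (a * v') = cs.length a + cs.length v' ∧
    ∀ u, IsPrefix cs u v → cs.length (a * u) = cs.length a + cs.length u → IsPrefix cs u v' := by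
  classical
  let P : ℕ → Prop := fun n => ∃ u, IsPrefix cs u v ∧
    cs.length (a * u) = cs.length a + cs.length u ∧ cs.length u = n
  have h0 : P 0 := ⟨1, ⟨v, by simp⟩, by simp, by simp⟩
  have hbound : ∀ n, P n → n ≤ cs.length v := by
    rintro n ⟨u, hu, -, rfl⟩
    exact hu.length_le
  obtain ⟨v', hv', hav', hl⟩ := Nat.findGreatest_spec (P := P) (Nat.zero_le (cs.length v)) h0
  refine ⟨v', hv', hav', fun u hu hau => ?_⟩
  obtain ⟨p, hup, hvp, hpv, hap⟩ := exists_common_upper_bound a v (cs.length v) 1 u v' (by lia)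
    ⟨u, by simp⟩ ⟨v', by simp⟩ hu hv' hau hav'
  have hmax := Nat.le_findGreatest (P := P) hpv.length_le ⟨p, hpv, hap, rfl⟩
  rw [← hl] at hmax
  rwa [hvp.eq_of_length_le hmax]

variable (cs)

/-- The longest prefix `v'` of `v` such that the lengths of `a` and `v'` add up in `a * v'`. -/
noncomputable def maxPrefix (a v : W) : W := (exists_max_prefix (cs := cs) a v).choose

theorem maxPrefix_isPrefix (a v : W) : IsPrefix cs (maxPrefix cs a v) v :=
  (exists_max_prefix (cs := cs) a v).choose_spec.1

theorem length_mul_maxPrefix (a v : W) :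
    cs.length (a * maxPrefix cs a v) = cs.length a + cs.length (maxPrefix cs a v) :=
  (exists_max_prefix (cs := cs) a v).choose_spec.2.1

theorem isPrefix_maxPrefix {a v u : W} (hu : IsPrefix cs u v)
    (hau : cs.length (a * u) = cs.length a + cs.length u) : IsPrefix cs u (maxPrefix cs a v) :=
  (exists_max_prefix (cs := cs) a v).choose_spec.2.2 u hu hau

/-- The head of a product is computed by absorbing the factors one after the other. -/
theorem mul_maxPrefix_mul {a b : W} (hab : cs.length (a * b) = cs.length a + cs.length b) (v : W) :
    maxPrefix cs a (b * maxPrefix cs b v) = b * maxPrefix cs (a * b) v := by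
  have hb := length_mul_maxPrefix cs b v
  have hbp : IsPrefix cs b (b * maxPrefix cs b v) := ⟨_, rfl, hb⟩
  -- The left side begins with `b`; write it as `b * x`. Then `x` and `maxPrefix cs (a * b) v` are
  -- prefixes of each other by maximality.
  obtain ⟨x, hx, hlx⟩ := isPrefix_maxPrefix cs hbp hab
  have hxpre : IsPrefix cs x (maxPrefix cs b v) := by
    rw [← isPrefix_mul_left_iff hb (by rw [← hx]; exact hlx), ← hx]
    exact maxPrefix_isPrefix cs _ _
  have hax := length_mul_maxPrefix cs a (b * maxPrefix cs b v)
  rw [hx] at hax hlx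
  have habx : cs.length (a * b * x) = cs.length (a * b) + cs.length x := by
    rw [mul_assoc]; lia
  have h1 : IsPrefix cs x (maxPrefix cs (a * b) v) :=
    isPrefix_maxPrefix cs (hxpre.trans (maxPrefix_isPrefix cs _ _)) habx
  set y := maxPrefix cs (a * b) v with hy
  have haby : cs.length (a * b * y) = cs.length (a * b) + cs.length y := length_mul_maxPrefix cs _ _
  have hby : cs.length (b * y) = cs.length b + cs.length y := by
    have h2 := cs.length_mul_le a (b * y)
    have h3 := cs.length_mul_le b y
    rw [← mul_assoc] at h2
    lia
  have h2 : IsPrefix cs y (maxPrefix cs b v) :=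
    isPrefix_maxPrefix cs (maxPrefix_isPrefix cs _ _) hby
  have h3 : IsPrefix cs (b * y) (b * x) := by
    rw [← hx]
    apply isPrefix_maxPrefix cs ((isPrefix_mul_left_iff hb hby).mpr h2)
    rw [← mul_assoc]
    lia
  rw [isPrefix_mul_left_iff hlx hby] at h3
  rw [hx, h1.eq_of_length_le h3.length_le]

end WeakOrder

end ArtinTits

namespace ArtinTits

variable {S : Type*} {C : CoxeterMatrix S}

/-! ### Words and length in the monoid. -/

section Words

/-- The element of the Artin–Tits monoid represented by a word. -/
def word (C : CoxeterMatrix S) (l : List S) : ArtinTitsMonoid C :=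
  PresentedMonoid.mk (BraidRel C) (FreeMonoid.ofList l)

/-- The image of a generator in the Artin–Tits monoid. -/
def gen (C : CoxeterMatrix S) (s : S) : ArtinTitsMonoid C := PresentedMonoid.of (BraidRel C) s

theorem word_nil : word C [] = 1 := rfl

theorem word_append (l l' : List S) : word C (l ++ l') = word C l * word C l' :=
  map_mul (PresentedMonoid.mk (BraidRel C)) (FreeMonoid.ofList l) (FreeMonoid.ofList l')

theorem word_cons (s : S) (l : List S) : word C (s :: l) = gen C s * word C l :=
  word_append [s] l

theorem word_surjective (g : ArtinTitsMonoid C) : ∃ l, word C l = g := by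
  obtain ⟨a, rfl⟩ := PresentedMonoid.surjective_mk g
  exact ⟨FreeMonoid.toList a, rfl⟩

theorem word_altList_braid {s t : S} (hst : s ≠ t) (h : C s t ≠ 0) :
    word C (altList s t (C s t)) = word C (altList t s (C s t)) := by
  have h := PresentedMonoid.mk_eq_mk_of_rel (BraidRel.braid s t hst h)
  rw [alternatingWord_eq_altList, alternatingWord_eq_altList] at h
  split_ifs at h
  · exact h
  · exact h.symm

/-- The homomorphism to a monoid determined by images of the generators that satisfy the braid
relations, in terms of alternating lists. -/
def liftHom {N : Type*} [Monoid N] (f : S → N)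
    (hf : ∀ s t, s ≠ t → C s t ≠ 0 →
      ((altList s t (C s t)).map f).prod = ((altList t s (C s t)).map f).prod) :
    ArtinTitsMonoid C →* N :=
  PresentedMonoid.lift f (by
    rintro _ _ ⟨s, t, hst, h⟩
    rw [alternatingWord_eq_altList, alternatingWord_eq_altList, FreeMonoid.lift_ofList,
      FreeMonoid.lift_ofList]
    split_ifs
    · exact hf s t hst h
    · exact (hf s t hst h).symm)

/-- The length homomorphism of the Artin–Tits monoid. -/
def lengthHom (C : CoxeterMatrix S) : ArtinTitsMonoid C →* Multiplicative ℕ :=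
  liftHom (fun _ => Multiplicative.ofAdd 1) (by simp)

/-- The length of an element of the Artin–Tits monoid. -/
def len (g : ArtinTitsMonoid C) : ℕ := (lengthHom C g).toAdd

theorem len_mul (f g : ArtinTitsMonoid C) : len (f * g) = len f + len g := by
  simp [len]

theorem len_gen (s : S) : len (gen C s) = 1 := rfl

theorem len_word (l : List S) : len (word C l) = l.length := by
  induction l with
  | nil => simp [word_nil, len]
  | cons s l ih => rw [word_cons, len_mul, len_gen, ih, List.length_cons, add_comm]

theorem len_eq_zero_iff {g : ArtinTitsMonoid C} : len g = 0 ↔ g = 1 := by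
  obtain ⟨l, rfl⟩ := word_surjective g
  rw [len_word, List.length_eq_zero_iff]
  constructor
  · rintro rfl
    rfl
  · intro h
    rw [← List.length_eq_zero_iff, ← len_word (C := C), h, ← word_nil, len_word, List.length_nil]

theorem exists_eq_gen_mul {g : ArtinTitsMonoid C} (hg : g ≠ 1) : ∃ s h, g = gen C s * h := by
  obtain ⟨l, rfl⟩ := word_surjective g
  cases l with
  | nil => exact absurd word_nil hg
  | cons s l => exact ⟨s, word C l, word_cons s l⟩

end Words

variable {W : Type*} [Group W] (cs : CoxeterSystem C W)

/-! ### Lifting the Coxeter group through reduced words. -/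

section ReducedLift

/-- Matsumoto's theorem: reduced words of the same element of the Coxeter group represent the same
element of the Artin–Tits monoid. -/
theorem word_eq_of_isReduced (n : ℕ) {ω ω' : List S} (hn : ω.length = n) (hω : cs.IsReduced ω)
    (hω' : cs.IsReduced ω') (h : cs.wordProd ω = cs.wordProd ω') : word C ω = word C ω' := by
  induction n generalizing ω ω' with
  | zero =>
    have hl : ω'.length = ω.length := by rw [← hω', ← hω, h]
    rw [List.length_eq_zero_iff.mp hn, List.length_eq_zero_iff.mp (hl.trans hn)]
  | succ n ih =>
    have hl : ω'.length = ω.length := by rw [← hω', ← hω, h]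
    obtain ⟨s, a, rfl⟩ := List.exists_cons_of_length_eq_add_one hn
    obtain ⟨t, b, rfl⟩ := List.exists_cons_of_length_eq_add_one (hl.trans hn)
    have ha : cs.IsReduced a := hω.drop 1
    have hb : cs.IsReduced b := hω'.drop 1
    simp only [List.length_cons, add_left_inj] at hn hl
    rw [word_cons, word_cons]
    rcases eq_or_ne s t with rfl | hst
    · rw [ih hn ha hb (by simpa [cs.wordProd_cons] using h)]
    have hs : cs.IsLeftDescent (cs.wordProd (s :: a)) s := by
      apply isLeftDescent_of_eq_simple_mul cs (cs.wordProd_cons s a)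
      rw [ha.eq, hω.eq, List.length_cons]
      lia
    have ht : cs.IsLeftDescent (cs.wordProd (s :: a)) t := by
      rw [h]
      apply isLeftDescent_of_eq_simple_mul cs (cs.wordProd_cons t b)
      rw [hb.eq, hω'.eq, List.length_cons]
      lia
    have hm := coxeterEntry_ne_zero_of_isLeftDescent cs hst hs ht
    obtain ⟨v, hv, hlv⟩ := exists_join_of_isLeftDescent cs hst hs ht
    obtain ⟨c, hc, rfl⟩ := cs.exists_isReduced v
    obtain ⟨k, hk⟩ := Nat.exists_eq_succ_of_ne_zero hm
    rw [hω.eq, hc.eq, List.length_cons] at hlv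
    have hbraid := wordProd_altList_braid cs s t
    have hword := word_altList_braid hst hm
    have hv' : cs.wordProd (t :: b) = cs.wordProd (altList t s (C s t)) * cs.wordProd c := by
      rw [← h, hv, hbraid]
    -- Each word is compared, after its common first letter, with one beginning with a full
    -- alternating word; the braid relation then identifies the two intermediaries.
    have key : ∀ (p q : S) (d : List S), cs.IsReduced d → d.length = n →
        cs.wordProd (p :: d) = cs.wordProd (altList p q (C s t)) * cs.wordProd c →
        gen C p * word C d = word C (altList p q (C s t)) * word C c := by
      intro p q d hd hdn he
      rw [hk, Nat.succ_eq_add_one, altList, cs.wordProd_cons, cs.wordProd_cons, mul_assoc,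
        mul_right_inj, ← cs.wordProd_append] at he
      rw [hk, Nat.succ_eq_add_one, altList, word_cons, mul_assoc, ← word_append]
      congr 1
      apply ih hdn hd _ he
      rw [CoxeterSystem.IsReduced, ← he, hd.eq, List.length_append, length_altList]
      lia
    rw [key s t a ha hn hv, key t s b hb (hl.trans hn) hv', hword]

/-- The lift of an element of the Coxeter group to the Artin–Tits monoid through reduced words. -/
noncomputable def redLift (w : W) : ArtinTitsMonoid C := word C (cs.exists_isReduced w).choose

theorem redLift_wordProd {ω : List S} (hω : cs.IsReduced ω) :
    redLift cs (cs.wordProd ω) = word C ω := by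
  obtain ⟨h1, h2⟩ := (cs.exists_isReduced (cs.wordProd ω)).choose_spec
  exact word_eq_of_isReduced cs _ rfl h1 hω h2.symm

theorem redLift_mul {u v : W} (h : cs.length (u * v) = cs.length u + cs.length v) :
    redLift cs (u * v) = redLift cs u * redLift cs v := by
  obtain ⟨a, ha, rfl⟩ := cs.exists_isReduced u
  obtain ⟨b, hb, rfl⟩ := cs.exists_isReduced v
  have hab : cs.IsReduced (a ++ b) := by
    rw [CoxeterSystem.IsReduced, cs.wordProd_append, h, ha.eq, hb.eq, List.length_append]
  rw [← cs.wordProd_append, redLift_wordProd cs ha, redLift_wordProd cs hb,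
    redLift_wordProd cs hab, word_append]

theorem redLift_one : redLift cs 1 = 1 := by
  rw [← cs.wordProd_nil, redLift_wordProd cs (by simp [CoxeterSystem.IsReduced]), word_nil]

theorem redLift_simple (s : S) : redLift cs (cs.simple s) = gen C s := by
  rw [← cs.wordProd_singleton, redLift_wordProd cs (by simp [CoxeterSystem.IsReduced]),
    word_cons, word_nil, mul_one]

theorem redLift_of_isPrefix {u v : W} (h : IsPrefix cs u v) :
    redLift cs v = redLift cs u * redLift cs (u⁻¹ * v) := by
  obtain ⟨x, rfl, hx⟩ := h
  rw [redLift_mul cs hx, inv_mul_cancel_left]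

end ReducedLift

/-! ### The head-tail action, left cancellation and lcms of generators. -/

section HeadTail

/-- Left multiplication by (the lift of) `u` on pairs of a head in the Coxeter group and a tail in
the Artin–Tits monoid. -/
noncomputable def headTailMul (u : W) : Function.End (W × ArtinTitsMonoid C) := fun p =>
  (u * maxPrefix cs u p.1, redLift cs ((maxPrefix cs u p.1)⁻¹ * p.1) * p.2)

/-- This is what makes the action respect the braid relations. Heads agree by `mul_maxPrefix_mul`;
tails agree because the nested prefixes `x` of `y` of `v` cut `v` into pieces with additive lengths.
-/
theorem headTailMul_mul {a b : W} (hab : cs.length (a * b) = cs.length a + cs.length b) :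
    headTailMul cs (a * b) = headTailMul cs a * headTailMul cs b := by
  funext ⟨v, m⟩
  change _ = headTailMul cs a (headTailMul cs b (v, m))
  have h := mul_maxPrefix_mul cs hab v
  simp only [headTailMul, h]
  refine Prod.ext (mul_assoc _ _ _) ?_
  simp only [mul_inv_rev, mul_assoc, inv_mul_cancel_left]
  rw [← mul_assoc (redLift cs _) (redLift cs _) m]
  congr 1
  set x := maxPrefix cs (a * b) v
  set y := maxPrefix cs b v
  have hyv : IsPrefix cs y v := maxPrefix_isPrefix cs _ _
  have hxv : IsPrefix cs x v := maxPrefix_isPrefix cs _ _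
  have hxy : IsPrefix cs x y := by
    apply isPrefix_maxPrefix cs hxv
    have h1 := length_mul_maxPrefix cs (a * b) v
    have h2 := cs.length_mul_le a (b * x)
    have h3 := cs.length_mul_le b x
    rw [← mul_assoc] at h2
    change cs.length (a * b * x) = _ + cs.length x at h1
    lia
  obtain ⟨c, hc, hlc⟩ := hyv
  obtain ⟨d, hd, hld⟩ := hxy
  have h1 := hxv.length_le
  have h2 := cs.length_mul_le x (d * c)
  have h3 := cs.length_mul_le d c
  rw [hc, hd, mul_assoc] at hlc
  rw [hd] at hld
  rw [hc, hd, mul_inv_rev, inv_mul_cancel_left]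
  simp only [mul_assoc, inv_mul_cancel_left]
  exact redLift_mul cs (by lia)

theorem headTailMul_one : headTailMul cs (1 : W) = 1 := by
  funext ⟨v, m⟩
  have : maxPrefix cs 1 v = v := (maxPrefix_isPrefix cs 1 v).eq_of_length_le
    (isPrefix_maxPrefix cs (IsPrefix.refl v) (by simp)).length_le
  simp only [headTailMul, this, one_mul, inv_mul_cancel, redLift_one]
  rfl

theorem prod_map_headTailMul {ω : List S} (hω : cs.IsReduced ω) :
    (ω.map fun s => headTailMul cs (cs.simple s)).prod = headTailMul cs (cs.wordProd ω) := by
  induction ω with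
  | nil => simp [headTailMul_one]
  | cons s ω ih =>
    have hω' : cs.IsReduced ω := hω.drop 1
    rw [List.map_cons, List.prod_cons, ih hω', cs.wordProd_cons, headTailMul_mul]
    rw [← cs.wordProd_cons, hω.eq, hω'.eq, cs.length_simple, List.length_cons, add_comm]

/-- The action of the Artin–Tits monoid on pairs of a head and a tail. -/
noncomputable def headTailHom : ArtinTitsMonoid C →* Function.End (W × ArtinTitsMonoid C) :=
  liftHom (fun s => headTailMul cs (cs.simple s)) (by
    intro s t hst h
    rw [prod_map_headTailMul cs (isReduced_altList cs hst (Or.inl le_rfl)),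
      prod_map_headTailMul cs (isReduced_altList cs hst.symm (Or.inl (C.symmetric s t).le)),
      wordProd_altList_braid])

/-- The greedy decomposition of an element of the Artin–Tits monoid into its head, the largest
left-divisor coming from the Coxeter group, and its tail. -/
noncomputable def headTail (g : ArtinTitsMonoid C) : W × ArtinTitsMonoid C :=
  headTailHom cs g (1, 1)

theorem headTail_gen_mul (s : S) (g : ArtinTitsMonoid C) :
    headTail cs (gen C s * g) = headTailMul cs (cs.simple s) (headTail cs g) := by
  rw [headTail, map_mul]
  rfl

theorem redLift_mul_headTailMul (u : W) (p : W × ArtinTitsMonoid C) :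
    redLift cs (headTailMul cs u p).1 * (headTailMul cs u p).2 =
      redLift cs u * (redLift cs p.1 * p.2) := by
  rw [headTailMul, redLift_mul cs (length_mul_maxPrefix cs u p.1),
    redLift_of_isPrefix cs (maxPrefix_isPrefix cs u p.1)]
  simp only [mul_assoc]

theorem redLift_mul_headTail (g : ArtinTitsMonoid C) :
    redLift cs (headTail cs g).1 * (headTail cs g).2 = g := by
  obtain ⟨l, rfl⟩ := word_surjective g
  induction l with
  | nil =>
    rw [word_nil, headTail, map_one]
    change redLift cs 1 * 1 = 1
    rw [redLift_one, mul_one]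
  | cons s l ih =>
    rw [word_cons, headTail_gen_mul, redLift_mul_headTailMul, ih, redLift_simple]

/-- The head of `gen C s * g` is `s` times a prefix of the head of `g`, and its tail is the
remainder of `g`. Cancelling `s` in the group therefore reconstructs `g`. -/
theorem gen_mul_left_cancel {s : S} {g h : ArtinTitsMonoid C} (e : gen C s * g = gen C s * h) :
    g = h := by
  have he := congrArg (headTail C.toCoxeterSystem) e
  rw [headTail_gen_mul, headTail_gen_mul] at he
  obtain ⟨h1, h2⟩ := Prod.ext_iff.mp he
  have h1' := mul_left_cancel h1
  rw [← redLift_mul_headTail C.toCoxeterSystem g, ← redLift_mul_headTail C.toCoxeterSystem h,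
    redLift_of_isPrefix _ (maxPrefix_isPrefix _ (C.toCoxeterSystem.simple s) _), mul_assoc]
  conv_rhs => rw [redLift_of_isPrefix _
    (maxPrefix_isPrefix C.toCoxeterSystem (C.toCoxeterSystem.simple s) _), mul_assoc]
  exact congrArg₂ (· * ·) (congrArg _ h1') h2

instance isLeftCancelMul : IsLeftCancelMul (ArtinTitsMonoid C) where
  mul_left_cancel f g h e := by
    obtain ⟨l, rfl⟩ := word_surjective f
    induction l with
    | nil => simpa [word_nil] using e
    | cons s l ih =>
      simp only [word_cons, mul_assoc] at e
      exact ih (gen_mul_left_cancel e)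

theorem isLeftDescent_of_gen_dvd {s : S} {g : ArtinTitsMonoid C} (h : gen C s ∣ g) :
    cs.IsLeftDescent (headTail cs g).1 s := by
  obtain ⟨g, rfl⟩ := h
  rw [headTail_gen_mul]
  have := length_mul_maxPrefix cs (cs.simple s) (headTail cs g).1
  rw [cs.length_simple] at this
  refine isLeftDescent_of_eq_simple_mul cs rfl ?_
  simp only [headTailMul]
  lia

/-- Two distinct generators with a common right-multiple have a right-lcm. -/
theorem exists_isRightLcm_gen {s t : S} {g : ArtinTitsMonoid C} (hs : gen C s ∣ g)
    (ht : gen C t ∣ g) : ∃ h, IsRightLcm (gen C s) (gen C t) h := by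
  rcases eq_or_ne s t with rfl | hst
  · exact ⟨gen C s, dvd_rfl, dvd_rfl, fun _ h _ => h⟩
  set cs := C.toCoxeterSystem
  have hm := coxeterEntry_ne_zero_of_isLeftDescent cs hst (isLeftDescent_of_gen_dvd cs hs)
    (isLeftDescent_of_gen_dvd cs ht)
  obtain ⟨k, hk⟩ := Nat.exists_eq_succ_of_ne_zero hm
  refine ⟨word C (altList s t (C s t)), ?_, ?_, ?_⟩
  · rw [hk, Nat.succ_eq_add_one, altList, word_cons]
    exact dvd_mul_right _ _
  · rw [word_altList_braid hst hm, hk, Nat.succ_eq_add_one, altList, word_cons]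
    exact dvd_mul_right _ _
  -- The head of `f` has both descents, so it begins with the full alternating word, and this
  -- factorization lifts.
  · intro f hsf htf
    obtain ⟨v, hv, hl⟩ := exists_join_of_isLeftDescent cs hst (isLeftDescent_of_gen_dvd cs hsf)
      (isLeftDescent_of_gen_dvd cs htf)
    have hred := isReduced_altList cs hst (k := C s t) (Or.inl le_rfl)
    rw [← redLift_mul_headTail cs f, hv, redLift_mul cs, redLift_wordProd cs hred, mul_assoc]
    · exact dvd_mul_right _ _
    · rw [← hv, hl, hred.eq, length_altList]

end HeadTail

end ArtinTits

namespace ArtinTits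

variable {S : Type*} {C : CoxeterMatrix S}

/-! ### Divisibility and right-lcms. -/

section Divisibility

theorem eq_one_of_mul_eq_one {f g : ArtinTitsMonoid C} (h : f * g = 1) : f = 1 ∧ g = 1 := by
  rw [← len_eq_zero_iff, len_mul] at h
  rw [← len_eq_zero_iff, ← len_eq_zero_iff]
  lia

theorem len_le_of_dvd {f g : ArtinTitsMonoid C} (h : f ∣ g) : len f ≤ len g := by
  obtain ⟨x, rfl⟩ := h
  rw [len_mul]
  lia

theorem eq_of_dvd_of_len_le {f g : ArtinTitsMonoid C} (h : f ∣ g) (hl : len g ≤ len f) :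
    f = g := by
  obtain ⟨x, rfl⟩ := h
  rw [len_mul] at hl
  rw [len_eq_zero_iff.mp (show len x = 0 by lia), mul_one]

theorem dvd_antisymm_of_artinTits {f g : ArtinTitsMonoid C} (h : f ∣ g) (h' : g ∣ f) : f = g :=
  eq_of_dvd_of_len_le h (len_le_of_dvd h')

theorem isRightLcm_mul_left {M : Type*} [Monoid M] [IsLeftCancelMul M] {f g h : M} (a : M)
    (H : IsRightLcm f g h) : IsRightLcm (a * f) (a * g) (a * h) := by
  refine ⟨mul_dvd_mul_left a H.1, mul_dvd_mul_left a H.2.1, ?_⟩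
  rintro _ ⟨x, rfl⟩ ⟨y, hy⟩
  rw [mul_assoc] at hy ⊢
  rw [mul_assoc, mul_right_inj] at hy
  exact mul_dvd_mul_left a (H.2.2 _ (dvd_mul_right f x) ⟨y, hy⟩)

theorem dvd_of_mul_dvd_mul_left {M : Type*} [Monoid M] [IsLeftCancelMul M] {a f g : M}
    (h : a * f ∣ a * g) : f ∣ g := by
  obtain ⟨x, hx⟩ := h
  rw [mul_assoc, mul_right_inj] at hx
  exact ⟨x, hx⟩

/-- Two elements of an Artin–Tits monoid with a common right-multiple have a right-lcm. -/
theorem exists_isRightLcm (n : ℕ) {f g h : ArtinTitsMonoid C} (hn : len h ≤ n) (hf : f ∣ h)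
    (hg : g ∣ h) : ∃ k, IsRightLcm f g k := by
  induction n generalizing f g h with
  | zero =>
    rw [eq_of_dvd_of_len_le hf (by lia), eq_of_dvd_of_len_le hg (by lia)]
    exact ⟨h, dvd_rfl, dvd_rfl, fun _ h _ => h⟩
  | succ n ih =>
    rcases eq_or_ne f 1 with rfl | hf1
    · exact ⟨g, one_dvd g, dvd_rfl, fun _ _ h => h⟩
    rcases eq_or_ne g 1 with rfl | hg1
    · exact ⟨f, dvd_rfl, one_dvd f, fun _ h _ => h⟩
    obtain ⟨s, f', rfl⟩ := exists_eq_gen_mul hf1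
    obtain ⟨t, g', rfl⟩ := exists_eq_gen_mul hg1
    -- Two divisors of `h` sharing a first letter are handled by cancelling it, which shortens `h`.
    have ihs : ∀ (r : S) {x y : ArtinTitsMonoid C}, gen C r * x ∣ h → gen C r * y ∣ h →
        ∃ k, IsRightLcm (gen C r * x) (gen C r * y) (gen C r * k) := by
      intro r x y hx hy
      obtain ⟨h', rfl⟩ := (dvd_mul_right _ _).trans hx
      rw [len_mul, len_gen] at hn
      obtain ⟨k, hk⟩ := ih (show len h' ≤ n by lia) (dvd_of_mul_dvd_mul_left hx)
        (dvd_of_mul_dvd_mul_left hy)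
      exact ⟨k, isRightLcm_mul_left _ hk⟩
    obtain ⟨d, hd⟩ := exists_isRightLcm_gen ((dvd_mul_right _ _).trans hf)
      ((dvd_mul_right _ _).trans hg)
    have hdh : d ∣ h := hd.2.2 _ ((dvd_mul_right _ _).trans hf) ((dvd_mul_right _ _).trans hg)
    obtain ⟨a, ha⟩ := hd.1
    obtain ⟨b, hb⟩ := hd.2.1
    obtain ⟨x, hx⟩ := ihs s hf (ha ▸ hdh)
    obtain ⟨y, hy⟩ := ihs t hg (hb ▸ hdh)
    rw [← ha] at hx
    rw [← hb] at hy
    have hxh := hx.2.2 _ hf hdh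
    have hyh := hy.2.2 _ hg hdh
    -- With `d` the lcm of the first letters, `x` and `y` complete `f` and `g` to lcms with `d`.
    -- Both lcms are divisible by `gen C s`, so a last application of `ihs` joins them.
    obtain ⟨y', hy'⟩ : gen C s ∣ gen C t * y := hd.1.trans hy.2.1
    rw [hy'] at hy hyh
    obtain ⟨z, hz⟩ := ihs s hxh hyh
    refine ⟨gen C s * z, hx.1.trans hz.1, hy.1.trans hz.2.1, fun k hfk hgk => ?_⟩
    have hdk : d ∣ k := hd.2.2 _ ((dvd_mul_right _ _).trans hfk) ((dvd_mul_right _ _).trans hgk)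
    exact hz.2.2 _ (hx.2.2 _ hfk hdk) (hy.2.2 _ hgk hdk)

theorem isAtomElement_gen (s : S) : IsAtomElement (gen C s) := by
  intro f hf
  have h := len_le_of_dvd hf
  rw [len_gen] at h
  rcases Nat.eq_zero_or_pos (len f) with h0 | h0
  · exact Or.inl (len_eq_zero_iff.mp h0)
  · exact Or.inr (eq_of_dvd_of_len_le hf (by rw [len_gen]; lia))

theorem isAtomElement_one : IsAtomElement (1 : ArtinTitsMonoid C) := by
  rintro f ⟨g, hg⟩
  exact Or.inl (eq_one_of_mul_eq_one hg.symm).1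

end Divisibility

/-! ### Garside families and closed families. -/

section Garside

variable {F : Set (ArtinTitsMonoid C)}

/-- The right-complement of a member of `F` with respect to an arbitrary element lies in `F`. -/
theorem exists_right_complement_mem (hgen : ∀ s, gen C s ∈ F)
    (hlcm : ClosedUnderRightLcm F) (hdiv : ClosedUnderRightDivisor F)
    {f h s : ArtinTitsMonoid C} (hs : s ∈ F) (hsh : s ∣ h) (hfh : f ∣ h) :
    ∃ r ∈ F, s ∣ f * r ∧ f * r ∣ h := by
  obtain ⟨l, rfl⟩ := word_surjective f
  induction l generalizing s h with
  | nil => exact ⟨s, hs, by simp [word_nil], by simpa [word_nil] using hsh⟩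
  | cons a l ih =>
    rw [word_cons] at hfh ⊢
    -- One letter at a time: the lcm of `s` and `gen C a` lies in `F`, and so does its right-divisor
    -- `r`, which takes the place of `s` for the remaining word.
    obtain ⟨k, hk⟩ := exists_isRightLcm _ le_rfl hsh ((dvd_mul_right _ _).trans hfh)
    obtain ⟨r, rfl⟩ := hk.2.1
    have hr : r ∈ F := hdiv _ (hlcm _ hs _ (hgen a) _ hk) _ ⟨gen C a, rfl⟩
    obtain ⟨h', rfl⟩ := (dvd_mul_right _ _).trans hfh
    obtain ⟨q, hq, hrq, hqh⟩ := ih hr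
      (dvd_of_mul_dvd_mul_left (hk.2.2 _ hsh (dvd_mul_right _ _))) (dvd_of_mul_dvd_mul_left hfh)
    refine ⟨q, hq, hk.1.trans ?_, ?_⟩
    · rw [mul_assoc]
      exact mul_dvd_mul_left _ hrq
    · rw [mul_assoc]
      exact mul_dvd_mul_left _ hqh

/-- Every element has a greatest left-divisor in a family closed under right-lcm. -/
theorem exists_greatest_dvd (hone : 1 ∈ F) (hlcm : ClosedUnderRightLcm F)
    (g : ArtinTitsMonoid C) : ∃ s ∈ F, s ∣ g ∧ ∀ r ∈ F, r ∣ g → r ∣ s := by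
  classical
  let P : ℕ → Prop := fun n => ∃ s ∈ F, s ∣ g ∧ len s = n
  have h0 : P 0 := ⟨1, hone, one_dvd g, len_eq_zero_iff.mpr rfl⟩
  obtain ⟨s, hs, hsg, hl⟩ := Nat.findGreatest_spec (P := P) (Nat.zero_le (len g)) h0
  refine ⟨s, hs, hsg, fun r hr hrg => ?_⟩
  obtain ⟨k, hk⟩ := exists_isRightLcm _ le_rfl hsg hrg
  have hkg := hk.2.2 _ hsg hrg
  have hmax := Nat.le_findGreatest (P := P) (len_le_of_dvd hkg)
    ⟨k, hlcm _ hs _ hr _ hk, hkg, rfl⟩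
  rw [eq_of_dvd_of_len_le hk.1 (by lia)]
  exact hk.2.1

theorem exists_isNormalDecomposition (hgen : ∀ s, gen C s ∈ F) (hone : 1 ∈ F)
    (hlcm : ClosedUnderRightLcm F) (hdiv : ClosedUnderRightDivisor F) (n : ℕ)
    {g : ArtinTitsMonoid C} (hn : len g ≤ n) :
    ∃ l : List (ArtinTitsMonoid C), IsNormalDecomposition F l g := by
  induction n generalizing g with
  | zero =>
    rw [len_eq_zero_iff.mp (Nat.le_zero.mp hn)]
    exact ⟨[], rfl, by simp, by simp⟩
  | succ n ih =>
    rcases eq_or_ne g 1 with rfl | hg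
    · exact ⟨[], rfl, by simp, by simp⟩
    obtain ⟨a, ha, ⟨g', rfl⟩, hmax⟩ := exists_greatest_dvd hone hlcm g
    -- The greatest divisor is nontrivial because `F` contains the generators; this makes the
    -- recursion terminate.
    have hapos : 0 < len a := by
      obtain ⟨s, h, hs⟩ := exists_eq_gen_mul hg
      have := len_le_of_dvd (hmax _ (hgen s) ⟨h, hs⟩)
      rwa [len_gen] at this
    rw [len_mul] at hn
    obtain ⟨l, hl⟩ := ih (show len g' ≤ n by lia)
    refine ⟨a :: l, ?_, ?_, ?_⟩
    · rw [List.prod_cons, hl.prod_eq]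
    · simpa using ⟨ha, hl.mem⟩
    · rintro (_ | i) hi
      · intro s hs f hsf
        simp only [List.getElem_cons_zero, List.getElem_cons_succ, zero_add] at hsf ⊢
        have hdvd : a * l[0]'(by simpa using hi) ∣ a * g' := by
          apply mul_dvd_mul_left
          rw [← hl.prod_eq]
          obtain ⟨b, l', rfl⟩ := List.exists_cons_of_length_pos
            (show 0 < l.length by simpa using hi)
          simp
        -- The multiplier `f` is removed by replacing `s` with a complement `r` in `F`; then `r`
        -- divides `a * g'`, hence `a` by maximality.
        obtain ⟨r, hr, hsr, hrd⟩ := exists_right_complement_mem hgen hlcm hdiv hs hsf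
          (f := f) (by rw [mul_assoc]; exact dvd_mul_right _ _)
        rw [mul_assoc] at hrd
        exact hsr.trans (mul_dvd_mul_left f
          (hmax r hr ((dvd_of_mul_dvd_mul_left hrd).trans hdvd)))
      · simpa using hl.greedy i (by simpa using hi)

theorem isGarsideFamily_of_closed (hatom : ∀ g : ArtinTitsMonoid C, IsAtomElement g → g ∈ F)
    (hlcm : ClosedUnderRightLcm F) (hdiv : ClosedUnderRightDivisor F) : IsGarsideFamily F where
  one_mem := hatom 1 isAtomElement_one
  exists_normal g := exists_isNormalDecomposition (fun s => hatom _ (isAtomElement_gen s))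
    (hatom 1 isAtomElement_one) hlcm hdiv _ (le_refl (len g))

/-- In a greedy sequence, every left-divisor in `F` of a left-multiple of the product already
divides the same left-multiple of the first entry. -/
theorem dvd_mul_head_of_greedy {M : Type*} [Monoid M] {F : Set M} {a : M} {l : List M}
    (h : ∀ (i : ℕ) (hi : i + 1 < (a :: l).length), IsGreedyPair F (a :: l)[i] (a :: l)[i + 1])
    {s : M} (hs : s ∈ F) (f : M) (hsf : s ∣ f * (a :: l).prod) : s ∣ f * a := by
  induction l generalizing a f with
  | nil => simpa using hsf
  | cons b l ih =>
    apply h 0 (by simp) s hs f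
    apply ih (a := b) _ (f * a)
    · rwa [List.prod_cons, ← mul_assoc] at hsf
    · intro i hi
      exact h (i + 1) (by simpa using hi)

/-- A Garside family contains, for every `g`, a left-divisor of `g` through which left-divisibility
by members of the family factors. -/
theorem IsGarsideFamily.exists_head {M : Type*} [Monoid M] {F : Set M} (hF : IsGarsideFamily F)
    (g : M) : ∃ a ∈ F, a ∣ g ∧ ∀ s ∈ F, ∀ f, s ∣ f * g → s ∣ f * a := by
  obtain ⟨l, hl⟩ := hF.exists_normal g
  cases l with
  | nil =>
    have : g = 1 := hl.prod_eq.symm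
    exact ⟨1, hF.one_mem, one_dvd g, fun s _ f h => by rwa [this] at h⟩
  | cons a l =>
    refine ⟨a, hl.mem a (by simp), ?_, fun s hs f h => ?_⟩
    · rw [← hl.prod_eq, List.prod_cons]
      exact dvd_mul_right _ _
    · rw [← hl.prod_eq] at h
      exact dvd_mul_head_of_greedy hl.greedy hs f h

theorem IsGarsideFamily.mem_of_isAtomElement (hF : IsGarsideFamily F) {g : ArtinTitsMonoid C}
    (hg : IsAtomElement g) : g ∈ F := by
  obtain ⟨l, hl, hmem, -⟩ := hF.exists_normal g
  induction l generalizing g with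
  | nil => rw [← hl]; exact hF.one_mem
  | cons a l ih =>
    rw [List.prod_cons] at hl
    rcases hg a ⟨_, hl.symm⟩ with rfl | rfl
    · rw [one_mul] at hl
      exact ih hg hl fun s hs => hmem s (List.mem_cons_of_mem _ hs)
    · exact hmem _ List.mem_cons_self

/-- The multiplier in the greedy condition is essential: `f * g` in `F` divides `f * a` for the head
`a` of `g`, and cancelling `f` gives `g = a`. -/
theorem IsGarsideFamily.closedUnderRightDivisor (hF : IsGarsideFamily F) :
    ClosedUnderRightDivisor F := by
  rintro s hs g ⟨f, rfl⟩
  obtain ⟨a, ha, hag, hmax⟩ := hF.exists_head g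
  have := dvd_of_mul_dvd_mul_left (hmax _ hs f dvd_rfl)
  rwa [dvd_antisymm_of_artinTits this hag]

/-- Both elements divide the head of their lcm, so the lcm divides its own head and equals it. -/
theorem IsGarsideFamily.closedUnderRightLcm (hF : IsGarsideFamily F) :
    ClosedUnderRightLcm F := by
  intro f hf g hg h hh
  obtain ⟨a, ha, hah, hmax⟩ := hF.exists_head h
  have hfa := hmax f hf 1
  have hga := hmax g hg 1
  rw [one_mul, one_mul] at hfa hga
  have := hh.2.2 a (hfa hh.1) (hga hh.2.1)
  rwa [dvd_antisymm_of_artinTits this hah]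

theorem isGarsideFamily_iff : IsGarsideFamily F ↔
    (∀ g : ArtinTitsMonoid C, IsAtomElement g → g ∈ F) ∧
      ClosedUnderRightLcm F ∧ ClosedUnderRightDivisor F :=
  ⟨fun hF => ⟨fun _ => hF.mem_of_isAtomElement, hF.closedUnderRightLcm,
    hF.closedUnderRightDivisor⟩, fun h => isGarsideFamily_of_closed h.1 h.2.1 h.2.2⟩

theorem isLeast_lcmDivisorClosure :
    IsLeast {G : Set (ArtinTitsMonoid C) | IsGarsideFamily G}
      (lcmDivisorClosure {g | IsAtomElement g}) := by
  constructor
  · exact isGarsideFamily_iff.mpr ⟨fun g hg => InClosure.base g hg,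
      fun f hf g hg h hh => InClosure.rightLcm f g h hf hg hh,
      fun g hg f hf => InClosure.rightDivisor f g hg hf⟩
  · intro G hG g hg
    obtain ⟨hatom, hlcm, hdiv⟩ := isGarsideFamily_iff.mp hG
    induction hg with
    | base g hg => exact hatom g hg
    | rightLcm f g h _ _ hh hf hg => exact hlcm f hf g hg h hh
    | rightDivisor f g _ hf hg => exact hdiv g hg f hf

end Garside

end ArtinTits

theorem proposition2p2 {S : Type*} (C : CoxeterMatrix S) :
    IsLeftCancelMul (ArtinTits.ArtinTitsMonoid C) ∧
    (∀ f g : ArtinTits.ArtinTitsMonoid C, f * g = 1 → f = 1 ∧ g = 1) ∧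
    (∀ F : Set (ArtinTits.ArtinTitsMonoid C),
      ArtinTits.IsGarsideFamily F ↔
        (∀ g : ArtinTits.ArtinTitsMonoid C, ArtinTits.IsAtomElement g → g ∈ F) ∧
        ArtinTits.ClosedUnderRightLcm F ∧
        ArtinTits.ClosedUnderRightDivisor F) ∧
    (∀ F : Set (ArtinTits.ArtinTitsMonoid C),
      IsLeast {G : Set (ArtinTits.ArtinTitsMonoid C) | ArtinTits.IsGarsideFamily G} F ↔
        F = ArtinTits.lcmDivisorClosure
          {g : ArtinTits.ArtinTitsMonoid C | ArtinTits.IsAtomElement g}) :=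
  ⟨ArtinTits.isLeftCancelMul, fun _ _ => ArtinTits.eq_one_of_mul_eq_one,
    fun _ => ArtinTits.isGarsideFamily_iff, fun _ =>
      ⟨fun h => h.unique ArtinTits.isLeast_lcmDivisorClosure,
        fun h => h ▸ ArtinTits.isLeast_lcmDivisorClosure⟩⟩
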